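/- Let $\mathbb{B}=\{q\in\mathbb{H}:|q|<1\}$ be the open unit ball of the quaternions, $\mathrm{Sp}(1)=\{u\in\mathbb{H}:|u|=1\}$, and $\mathrm{Sp}(1,1)=\{A\in M_2(\mathbb{H}):A^*I_{1,1}A=I_{1,1}\}$ with $I_{1,1}=\operatorname{diag}(1,-1)$, a Lie group with its manifold structure as a closed embedded submanifold of $M_2(\mathbb{H})\cong\mathbb{R}^{16}$. Let $\mathrm{Sp}(1)\times\{1\}=\{\operatorname{diag}(u,1):u\in\mathrm{Sp}(1)\}$ and $\mathrm{Sp}(1)I_2=\{\operatorname{diag}(u,u):u\in\mathrm{Sp}(1)\}$, subgroups of $\mathrm{Sp}(1,1)$. For functions on $\mathbb{B}$ with expansions $f(q)=\sum_n q^na_n$ and $g(q)=\sum_n q^nb_n$, let $(f*g)(q)=\sum_n q^n\sum_{k=0}^n a_kb_{n-k}$, $f^c(q)=\sum_n q^n\overline{a}_n$, $f^s=f*f^c$ and $f^{-*}=\frac{1}{f^s}f^c$. For $A=\begin{pmatrix}a&c\\ b&d\end{pmatrix}\in\mathrm{Sp}(1,1)$ the regular Möbius transformation is $\mathcal{F}_A=l_{(c,d)}^{-*}*l_{(a,b)}$,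 where $l_{(a,b)}(q)=qa+b$. Theorem. Each $\mathcal{F}_A$, $A\in\mathrm{Sp}(1,1)$, is a bijection of $\mathbb{B}$ onto $\mathbb{B}$. The double coset space $$D=(\mathrm{Sp}(1)\times\{1\})\backslash\mathrm{Sp}(1,1)/\mathrm{Sp}(1)I_2,$$ with the quotient topology, is Hausdorff and second countable, and it carries a natural smooth manifold structure, of dimension $4$: there is one and only one smooth manifold structure on $D$, compatible with its topology, for which the projection $\mathrm{Sp}(1,1)\to D$ is a submersion (a surjective smooth map whose differential at every point is surjective). For this structure, the map $$D\to\mathbb{B},\qquad (\mathrm{Sp}(1)\times\{1\})\,A\,\mathrm{Sp}(1)I_2\mapsto\big(\mathcal{F}_{A^{-1}}\big)^{-1}(0),$$ is well defined and is a diffeomorphism. -/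

import Mathlib

open scoped Manifold ContDiff Quaternion Topology Matrix Matrix.Norms.Operator

noncomputable section

namespace RegMobius

/-! ### The group `Sp(1,1)` -/

/-- The `2 × 2` matrices over the quaternions. -/
abbrev M₂ : Type := Matrix (Fin 2) (Fin 2) ℍ[ℝ]

/-- The usual topology of `M₂(ℍ)`, spelled as the topology of the norm in use here, so that the
topological and the normed structures agree for instance search. -/
instance : TopologicalSpace M₂ :=
  (Matrix.linftyOpNormedRing :
    NormedRing M₂).toMetricSpace.toPseudoMetricSpace.toUniformSpace.toTopologicalSpace

lemma topology_eq : (inferInstance : TopologicalSpace M₂) = instTopologicalSpaceMatrix := rfl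

/-- The matrix `I_{1,1} = diag(1,-1)`. -/
def J : M₂ := !![1, 0; 0, -1]

lemma J_mul_J : J * J = 1 := by
  rw [J, Matrix.one_fin_two]; simp

lemma J_conjTranspose : Jᴴ = J :=
  Matrix.ext fun i j => by fin_cases i <;> fin_cases j <;> simp [J]

/-- `Sp(1,1) = {A ∈ M₂(ℍ) : A* I_{1,1} A = I_{1,1}}`, as a submonoid of `M₂(ℍ)`. -/
def Sp11 : Submonoid M₂ where
  carrier := {A | Aᴴ * J * A = J}
  one_mem' := by simp
  mul_mem' {A B} hA hB := by
    simp only [Set.mem_ofPred_eq] at *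
    rw [Matrix.conjTranspose_mul,
      show Bᴴ * Aᴴ * J * (A * B) = Bᴴ * (Aᴴ * J * A) * B by simp only [mul_assoc], hA, hB]

lemma mem_Sp11 {A : M₂} : A ∈ Sp11 ↔ Aᴴ * J * A = J := Iff.rfl

lemma inv_mul_aux {A : M₂} (hA : A ∈ Sp11) : J * Aᴴ * J * A = 1 := by
  rw [mul_assoc, mul_assoc, ← mul_assoc Aᴴ, mem_Sp11.1 hA, J_mul_J]

lemma inv_mem_aux {A : M₂} (hA : A ∈ Sp11) : J * Aᴴ * J ∈ Sp11 := by
  have h : A * (J * Aᴴ * J) = 1 := mul_eq_one_comm.1 (inv_mul_aux hA)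
  rw [mem_Sp11]
  simp only [Matrix.conjTranspose_mul, Matrix.conjTranspose_conjTranspose, J_conjTranspose]
  calc J * (A * J) * J * (J * Aᴴ * J) = J * A * (J * J) * (J * Aᴴ * J) := by
        simp only [mul_assoc]
    _ = J * (A * (J * Aᴴ * J)) := by rw [J_mul_J, mul_one, mul_assoc]
    _ = J := by rw [h, mul_one]

/-- The group structure of `Sp(1,1)`: matrix multiplication, with `A⁻¹ = I_{1,1} A* I_{1,1}`. -/
instance : Group Sp11 :=
  { (inferInstance : Monoid Sp11) with
    inv := fun A => ⟨J * (A : M₂)ᴴ * J, inv_mem_aux A.2⟩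
    inv_mul_cancel := fun A => Subtype.ext (inv_mul_aux A.2) }

lemma coe_inv_mul (A : Sp11) : ((A⁻¹ : Sp11) : M₂) * (A : M₂) = 1 := inv_mul_aux A.2

lemma coe_mul_inv (A : Sp11) : (A : M₂) * ((A⁻¹ : Sp11) : M₂) = 1 :=
  mul_eq_one_comm.1 (coe_inv_mul A)

/-! ### The manifold structure of `Sp(1,1)` -/

/-- The Lie algebra of `Sp(1,1)`, a real vector space of dimension `10`; it is the model space
of the manifold `Sp(1,1)`. -/
def sp11 : Submodule ℝ M₂ where
  carrier := {Y | Yᴴ * J + J * Y = 0}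
  zero_mem' := by simp
  add_mem' {X Y} hX hY := by
    simp only [Set.mem_ofPred_eq] at *
    rw [Matrix.conjTranspose_add, add_mul, mul_add, add_add_add_comm, hX, hY, add_zero]
  smul_mem' c X hX := by
    simp only [Set.mem_ofPred_eq] at *
    have h : (c • X)ᴴ = c • Xᴴ := Matrix.ext fun i j => by simp [Matrix.conjTranspose_apply]
    rw [h, smul_mul_assoc, mul_smul_comm, ← smul_add, hX,
      smul_zero]

lemma mem_sp11 {Y : M₂} : Y ∈ sp11 ↔ Yᴴ * J + J * Y = 0 := Iff.rfl

/-- The Cayley transform `X ↦ (1 - X)(1 + X)⁻¹` (equal to `0` where `1 + X` is not invertible). -/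
def cayley (X : M₂) : M₂ := (1 - X) * Ring.inverse (1 + X)

lemma cayley_one_add {X : M₂} (h : IsUnit (1 + X)) :
    1 + cayley X = (2 : ℝ) • Ring.inverse (1 + X) := by
  have : (1 : M₂) = (1 + X) * Ring.inverse (1 + X) := (Ring.mul_inverse_cancel _ h).symm
  calc 1 + cayley X = (1 + X) * Ring.inverse (1 + X) + (1 - X) * Ring.inverse (1 + X) := by
        rw [← this, cayley]
    _ = (2 : ℝ) • Ring.inverse (1 + X) := by rw [← add_mul, two_smul]; noncomm_ring

lemma cayley_one_sub {X : M₂} (h : IsUnit (1 + X)) :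
    1 - cayley X = (2 : ℝ) • (X * Ring.inverse (1 + X)) := by
  have : (1 : M₂) = (1 + X) * Ring.inverse (1 + X) := (Ring.mul_inverse_cancel _ h).symm
  calc 1 - cayley X = (1 + X) * Ring.inverse (1 + X) - (1 - X) * Ring.inverse (1 + X) := by
        rw [← this, cayley]
    _ = (2 : ℝ) • (X * Ring.inverse (1 + X)) := by rw [← sub_mul, two_smul]; noncomm_ring

lemma cayley_isUnit {X : M₂} (h : IsUnit (1 + X)) : IsUnit (1 + cayley X) := by
  rw [cayley_one_add h, isUnit_iff_exists]
  refine ⟨(2⁻¹ : ℝ) • (1 + X), ?_, ?_⟩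
  · rw [smul_mul_smul_comm, Ring.inverse_mul_cancel _ h]; norm_num
  · rw [smul_mul_smul_comm, Ring.mul_inverse_cancel _ h]; norm_num

lemma cayley_cayley {X : M₂} (h : IsUnit (1 + X)) : cayley (cayley X) = X := by
  have hu := cayley_isUnit h
  have key : 1 - cayley X = X * (1 + cayley X) := by
    rw [cayley_one_sub h, cayley_one_add h, mul_smul_comm]
  rw [cayley, key, mul_assoc, Ring.mul_inverse_cancel _ hu, mul_one]

lemma cayley_mem_sp11 {X : M₂} (hX : X ∈ Sp11) : cayley X ∈ sp11 := by
  by_cases h : IsUnit (1 + X)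
  · obtain ⟨u, hu⟩ := h
    have hV : Ring.inverse (1 + X) = ((u⁻¹ : M₂ˣ) : M₂) := by rw [← hu, Ring.inverse_unit]
    set V : M₂ := ((u⁻¹ : M₂ˣ) : M₂) with hVdef
    have h1 : (1 + X) * V = 1 := by rw [← hu]; exact u.mul_inv
    have h2 : V * (1 + X) = 1 := by rw [← hu]; exact u.inv_mul
    have h1' : Vᴴ * (1 + Xᴴ) = 1 := by
      simpa using congrArg Matrix.conjTranspose h1
    have comm : (1 - X) * V = V * (1 - X) := by
      have : (1 + X) * (1 - X) = (1 - X) * (1 + X) := by noncomm_ring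
      calc (1 - X) * V = V * ((1 + X) * (1 - X)) * V := by rw [← mul_assoc, h2, one_mul]
        _ = V * (1 - X) * ((1 + X) * V) := by rw [this]; simp only [mul_assoc]
        _ = V * (1 - X) := by rw [h1, mul_one]
    rw [mem_sp11, cayley, hV]
    have e : (1 - Xᴴ) * J * (1 + X) + (1 + Xᴴ) * J * (1 - X) = 0 := by
      have := mem_Sp11.1 hX
      have e' : (1 - Xᴴ) * J * (1 + X) + (1 + Xᴴ) * J * (1 - X)
          = (2 : ℝ) • (J - Xᴴ * J * X) := by rw [two_smul]; noncomm_ring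
      rw [e', this, sub_self, smul_zero]
    calc ((1 - X) * V)ᴴ * J + J * ((1 - X) * V)
        = Vᴴ * (1 - Xᴴ) * J * ((1 + X) * V) + Vᴴ * (1 + Xᴴ) * J * ((1 - X) * V) := by
          rw [h1, h1']; simp
      _ = Vᴴ * ((1 - Xᴴ) * J * (1 + X) + (1 + Xᴴ) * J * (1 - X)) * V := by noncomm_ring
      _ = 0 := by rw [e]; simp
  · rw [cayley, Ring.inverse_non_unit _ h, mul_zero]; exact zero_mem _

lemma cayley_mem_Sp11 {Y : M₂} (hY : Y ∈ sp11) (h : IsUnit (1 + Y)) : cayley Y ∈ Sp11 := by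
  have h1 := Ring.mul_inverse_cancel _ h
  set V : M₂ := Ring.inverse (1 + Y) with hVdef
  have h1' : Vᴴ * (1 + Yᴴ) = 1 := by simpa using congrArg Matrix.conjTranspose h1
  have e : (1 - Yᴴ) * J * (1 - Y) = (1 + Yᴴ) * J * (1 + Y) := by
    have e' : (1 - Yᴴ) * J * (1 - Y) - (1 + Yᴴ) * J * (1 + Y)
        = (-2 : ℝ) • (Yᴴ * J + J * Y) := by rw [neg_smul, two_smul]; noncomm_ring
    rw [mem_sp11.1 hY, smul_zero] at e'
    exact sub_eq_zero.1 e'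
  rw [mem_Sp11, cayley, ← hVdef]
  calc ((1 - Y) * V)ᴴ * J * ((1 - Y) * V) = Vᴴ * ((1 - Yᴴ) * J * (1 - Y)) * V := by
        simp [mul_assoc]
    _ = (Vᴴ * (1 + Yᴴ)) * J * ((1 + Y) * V) := by rw [e]; simp only [mul_assoc]
    _ = J := by rw [h1, h1', one_mul, mul_one]

lemma contDiffAt_cayley {X : M₂} (h : IsUnit (1 + X)) : ContDiffAt ℝ ∞ cayley X := by
  have hinv : ContDiffAt ℝ ∞ (Ring.inverse : M₂ → M₂) (1 + X) := by
    obtain ⟨u, hu⟩ := h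
    rw [← hu]; exact contDiffAt_ringInverse ℝ u
  have h2 : ContDiffAt ℝ ∞ (fun X : M₂ => 1 + X) X := contDiffAt_const.add contDiffAt_id
  exact (contDiffAt_const.sub contDiffAt_id).mul (hinv.comp X h2)

lemma isOpen_one_add : IsOpen {X : M₂ | IsUnit (1 + X)} :=
  Units.isOpen.preimage (continuous_const.add continuous_id)

/-- The inverse of the Cayley transform centred at `A₀`. -/
def cayleyInv (A₀ : Sp11) (Y : sp11) : Sp11 :=
  open Classical in
  if h : IsUnit (1 + (Y : M₂)) then A₀ * ⟨cayley Y, cayley_mem_Sp11 Y.2 h⟩ else A₀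

lemma coe_cayleyInv (A₀ : Sp11) {Y : sp11} (h : IsUnit (1 + (Y : M₂))) :
    (cayleyInv A₀ Y : M₂) = (A₀ : M₂) * cayley Y := by
  simp [cayleyInv, h]

lemma inv_mul_coe_cayleyInv (A₀ : Sp11) {Y : sp11} (h : IsUnit (1 + (Y : M₂))) :
    ((A₀⁻¹ * cayleyInv A₀ Y : Sp11) : M₂) = cayley Y := by
  rw [Submonoid.coe_mul, coe_cayleyInv A₀ h, ← mul_assoc, coe_inv_mul, one_mul]

/-- The Cayley chart of `Sp(1,1)` centred at `A₀`:
`A ↦ (1 - A₀⁻¹A)(1 + A₀⁻¹A)⁻¹`. -/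
def cayleyChart (A₀ : Sp11) : OpenPartialHomeomorph Sp11 sp11 where
  toFun A := ⟨cayley ((A₀⁻¹ * A : Sp11) : M₂), cayley_mem_sp11 (A₀⁻¹ * A).2⟩
  invFun := cayleyInv A₀
  source := {A | IsUnit (1 + ((A₀⁻¹ * A : Sp11) : M₂))}
  target := {Y | IsUnit (1 + (Y : M₂))}
  map_source' A hA := cayley_isUnit hA
  map_target' Y hY := by
    simp only [Set.mem_ofPred_eq] at hY ⊢
    rw [inv_mul_coe_cayleyInv A₀ hY]; exact cayley_isUnit hY
  left_inv' A hA := by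
    apply Subtype.ext
    rw [coe_cayleyInv A₀ (cayley_isUnit hA)]
    simp only [cayley_cayley hA]
    rw [Submonoid.coe_mul, ← mul_assoc, coe_mul_inv, one_mul]
  right_inv' Y hY := by
    apply Subtype.ext
    change cayley _ = _
    rw [inv_mul_coe_cayleyInv A₀ hY, cayley_cayley hY]
  open_source := by
    refine isOpen_one_add.preimage ?_
    change Continuous fun A : Sp11 => ((A₀⁻¹ : Sp11) : M₂) * (A : M₂)
    exact continuous_const.mul continuous_subtype_val
  open_target := isOpen_one_add.preimage continuous_subtype_val
  continuousOn_toFun := by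
    intro A hA
    refine ContinuousAt.continuousWithinAt ?_
    rw [Topology.IsInducing.subtypeVal.continuousAt_iff]
    have h1 : ContinuousAt (fun A : Sp11 => ((A₀⁻¹ : Sp11) : M₂) * (A : M₂)) A :=
      (continuous_const.mul continuous_subtype_val).continuousAt
    exact ContinuousAt.comp (f := fun A : Sp11 => ((A₀⁻¹ : Sp11) : M₂) * (A : M₂))
      (contDiffAt_cayley hA).continuousAt h1
  continuousOn_invFun := by
    intro Y hY
    have hY' : IsUnit (1 + (Y : M₂)) := hY
    refine ContinuousAt.continuousWithinAt ?_
    rw [Topology.IsInducing.subtypeVal.continuousAt_iff]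
    have h1 : ContinuousAt (fun Y : sp11 => (A₀ : M₂) * cayley Y) Y :=
      continuousAt_const.mul ((contDiffAt_cayley hY').continuousAt.comp
        continuous_subtype_val.continuousAt)
    refine h1.congr ?_
    filter_upwards [(isOpen_one_add.preimage continuous_subtype_val).mem_nhds hY'] with Z hZ
    exact (coe_cayleyInv A₀ hZ).symm

/-- A local homeomorphism `e` from `Sp(1,1)` to the model space is a chart of the embedded
submanifold `Sp(1,1) ⊆ M₂(ℍ) ≅ ℝ¹⁶` if its inverse is smooth as a map into `M₂(ℍ)`, and if it is
itself, around each point of its domain, the restriction of a smooth map defined on `M₂(ℍ)`. -/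
def IsSubmanifoldChart (e : OpenPartialHomeomorph Sp11 sp11) : Prop :=
  ContDiffOn ℝ ∞ (fun Y => ((e.symm Y : Sp11) : M₂)) e.target ∧
    ∀ A ∈ e.source, ∃ g : M₂ → sp11, ContDiffAt ℝ ∞ g (A : M₂) ∧
      ∀ᶠ B : Sp11 in 𝓝 A, g (B : M₂) = e B

lemma isSubmanifoldChart_cayleyChart (A₀ : Sp11) : IsSubmanifoldChart (cayleyChart A₀) := by
  constructor
  · intro Y hY
    have hY' : IsUnit (1 + (Y : M₂)) := hY
    have h1 : ContDiffAt ℝ ∞ (fun Y : sp11 => (A₀ : M₂) * cayley Y) Y :=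
      contDiffAt_const.mul ((contDiffAt_cayley hY').comp Y sp11.subtypeL.contDiff.contDiffAt)
    refine (h1.congr_of_eventuallyEq ?_).contDiffWithinAt
    filter_upwards [(isOpen_one_add.preimage continuous_subtype_val).mem_nhds hY'] with Z hZ
    exact coe_cayleyInv A₀ hZ
  · intro A hA
    obtain ⟨p, hp⟩ := sp11.subtype.exists_leftInverse_of_injective (Submodule.ker_subtype _)
    refine ⟨fun B => p (cayley (((A₀⁻¹ : Sp11) : M₂) * B)), ?_, Filter.Eventually.of_forall ?_⟩
    · have h1 : ContDiffAt ℝ ∞ (fun B : M₂ => ((A₀⁻¹ : Sp11) : M₂) * B) (A : M₂) :=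
        contDiffAt_const.mul contDiffAt_id
      have h2 : ContDiffAt ℝ ∞ cayley (((A₀⁻¹ : Sp11) : M₂) * (A : M₂)) := contDiffAt_cayley hA
      exact (LinearMap.toContinuousLinearMap p).contDiff.contDiffAt.comp _ (h2.comp _ h1)
    · intro B
      exact LinearMap.congr_fun hp (cayleyChart A₀ B)

/-- `Sp(1,1)` as a manifold: the atlas consists of all its charts as an embedded submanifold
of `M₂(ℍ)`. -/
instance : ChartedSpace sp11 Sp11 where
  atlas := {e | IsSubmanifoldChart e}
  chartAt := cayleyChart
  mem_chart_source A := by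
    change IsUnit (1 + ((A⁻¹ * A : Sp11) : M₂))
    rw [inv_mul_cancel, Submonoid.coe_one]
    exact isUnit_iff_exists.2 ⟨(2⁻¹ : ℝ) • 1, by
      rw [mul_smul_comm, mul_one, smul_add, ← add_smul]; norm_num, by
      rw [smul_mul_assoc, one_mul, smul_add, ← add_smul]; norm_num⟩
  chart_mem_atlas := isSubmanifoldChart_cayleyChart

instance : IsManifold 𝓘(ℝ, sp11) ∞ Sp11 := by
  refine isManifold_of_contDiffOn _ _ _ ?_
  intro e e' he he' Y hY
  simp only [modelWithCornersSelf_coe, modelWithCornersSelf_coe_symm, Function.id_comp,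
    Function.comp_id, Set.range_id, Set.inter_univ, Set.preimage_id,
    OpenPartialHomeomorph.trans_source, OpenPartialHomeomorph.symm_source] at hY ⊢
  obtain ⟨g, hg, hge⟩ := he'.2 (e.symm Y) hY.2
  have h1 : ContDiffAt ℝ ∞ (fun Y => ((e.symm Y : Sp11) : M₂)) Y :=
    he.1.contDiffAt (e.open_target.mem_nhds hY.1)
  refine ((hg.comp Y h1).congr_of_eventuallyEq ?_).contDiffWithinAt
  filter_upwards [(e.continuousAt_symm hY.1).eventually hge] with Z hZ
  simp [hZ]

/-! ### Quotients of `Sp(1,1)` -/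

/-- `Sp(1) × {1}`, diagonally embedded: the matrices `diag(u, 1)` with `|u| = 1`. -/
def leftSubgroup : Subgroup Sp11 where
  carrier := {A | ∃ u : ℍ[ℝ], ‖u‖ = 1 ∧ (A : M₂) = !![u, 0; 0, 1]}
  one_mem' := ⟨1, by simp, by simp [Matrix.one_fin_two]⟩
  mul_mem' := by
    rintro A B ⟨u, hu, hA⟩ ⟨v, hv, hB⟩
    exact ⟨u * v, by simp [hu, hv], by rw [Submonoid.coe_mul, hA, hB]; simp⟩
  inv_mem' := by
    rintro A ⟨u, hu, hA⟩
    refine ⟨star u, by simpa using hu, ?_⟩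
    change J * (A : M₂)ᴴ * J = _
    rw [hA]
    exact Matrix.ext fun i j => by
      fin_cases i <;> fin_cases j <;>
        simp [J, Matrix.mul_apply, Matrix.vecMul, Matrix.vecHead, Matrix.vecTail]

/-- `Sp(1) I₂`: the scalar matrices `u I₂` with `|u| = 1`. -/
def rightSubgroup : Subgroup Sp11 where
  carrier := {A | ∃ u : ℍ[ℝ], ‖u‖ = 1 ∧ (A : M₂) = !![u, 0; 0, u]}
  one_mem' := ⟨1, by simp, by simp [Matrix.one_fin_two]⟩
  mul_mem' := by
    rintro A B ⟨u, hu, hA⟩ ⟨v, hv, hB⟩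
    exact ⟨u * v, by simp [hu, hv], by rw [Submonoid.coe_mul, hA, hB]; simp⟩
  inv_mem' := by
    rintro A ⟨u, hu, hA⟩
    refine ⟨star u, by simpa using hu, ?_⟩
    change J * (A : M₂)ᴴ * J = _
    rw [hA]
    exact Matrix.ext fun i j => by
      fin_cases i <;> fin_cases j <;>
        simp [J, Matrix.mul_apply, Matrix.vecMul, Matrix.vecHead, Matrix.vecTail]

/-- The double coset space `(Sp(1) × {1}) \ Sp(1,1) / Sp(1) I₂`. -/
abbrev DCoset : Type := DoubleCoset.Quotient (leftSubgroup : Set Sp11) rightSubgroup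

/-- The projection `A ↦ (Sp(1) × {1}) A Sp(1) I₂`. -/
def proj (A : Sp11) : DCoset := DoubleCoset.mk leftSubgroup rightSubgroup A

/-- The quotient topology. -/
instance : TopologicalSpace DCoset := TopologicalSpace.coinduced proj inferInstance

/-- A submersion: a surjective smooth map whose differential is surjective at every point. -/
structure IsSubmersion {E E' H H' : Type*}
    [NormedAddCommGroup E] [NormedSpace ℝ E] [TopologicalSpace H]
    [NormedAddCommGroup E'] [NormedSpace ℝ E'] [TopologicalSpace H']
    (I : ModelWithCorners ℝ E H) (I' : ModelWithCorners ℝ E' H')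
    {M N : Type*} [TopologicalSpace M] [ChartedSpace H M]
    [TopologicalSpace N] [ChartedSpace H' N] (f : M → N) : Prop where
  contMDiff : ContMDiff I I' ∞ f
  surjective : Function.Surjective f
  mfderiv_surjective : ∀ x, Function.Surjective (mfderiv I I' f x)

/-- A charted space structure on the double coset space (with its quotient topology) is a natural
manifold structure if it is smooth and the projection from `Sp(1,1)` is a submersion. -/
structure IsNaturalStructure {n : ℕ} (cs : ChartedSpace (EuclideanSpace ℝ (Fin n)) DCoset) :
    Prop where
  isManifold : IsManifold (𝓡 n) ∞ DCoset
  isSubmersion : IsSubmersion 𝓘(ℝ, sp11) (𝓡 n) proj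

/-! ### The regular product and regular Möbius transformations -/

/-- The open unit ball of `ℍ`, as an open submanifold. -/
def ball : TopologicalSpace.Opens ℍ[ℝ] := ⟨Metric.ball 0 1, Metric.isOpen_ball⟩

/-- `f(q) = ∑ qⁿ aₙ` on the unit ball. The sequence of (right) coefficients is recorded as a
power series in a central variable, whose product is `cₙ = ∑ₖ aₖ bₙ₋ₖ`. -/
def HasExpansion (f : ℍ[ℝ] → ℍ[ℝ]) (a : PowerSeries ℍ[ℝ]) : Prop :=
  ∀ q ∈ ball, HasSum (fun n : ℕ => q ^ n * PowerSeries.coeff n a) (f q)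

/-- The (unique) coefficients of `f`; by convention `0` if `f` has no expansion. -/
def expansion (f : ℍ[ℝ] → ℍ[ℝ]) : PowerSeries ℍ[ℝ] :=
  open Classical in if h : ∃ a, HasExpansion f a then h.choose else 0

/-- The function `q ↦ ∑ qⁿ aₙ`. -/
def evalSeries (a : PowerSeries ℍ[ℝ]) (q : ℍ[ℝ]) : ℍ[ℝ] :=
  ∑' n : ℕ, q ^ n * PowerSeries.coeff n a

/-- The regular product `(f * g)(q) = ∑ qⁿ cₙ`, `cₙ = ∑ₖ aₖ bₙ₋ₖ`. -/
def starMul (f g : ℍ[ℝ] → ℍ[ℝ]) : ℍ[ℝ] → ℍ[ℝ] :=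
  evalSeries (expansion f * expansion g)

/-- The regular conjugate `f^c(q) = ∑ qⁿ āₙ`. -/
def regConj (f : ℍ[ℝ] → ℍ[ℝ]) : ℍ[ℝ] → ℍ[ℝ] :=
  evalSeries (PowerSeries.mk fun n => star (PowerSeries.coeff n (expansion f)))

/-- The symmetrization `f^s = f * f^c`. -/
def symmetrization (f : ℍ[ℝ] → ℍ[ℝ]) : ℍ[ℝ] → ℍ[ℝ] := starMul f (regConj f)

/-- The regular reciprocal `f^{-*} = (1 / f^s) f^c`. -/
def regInv (f : ℍ[ℝ] → ℍ[ℝ]) : ℍ[ℝ] → ℍ[ℝ] := fun q => (symmetrization f q)⁻¹ * regConj f q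

/-- `l_{(a,b)}(q) = q a + b`. -/
def lin (a b : ℍ[ℝ]) : ℍ[ℝ] → ℍ[ℝ] := fun q => q * a + b

/-- The regular Möbius transformation `𝓕_A = l_{(c,d)}^{-*} * l_{(a,b)}` of a matrix `A` with rows
`(a, c)` and `(b, d)`. Only its values on the unit ball are meaningful. -/
def regMobius (A : Sp11) : ℍ[ℝ] → ℍ[ℝ] :=
  starMul (regInv (lin ((A : M₂) 0 1) ((A : M₂) 1 1))) (lin ((A : M₂) 0 0) ((A : M₂) 1 0))

end RegMobius

end

open RegMobius

open scoped Manifold ContDiff Quaternion Topology Matrix Matrix.Norms.Operator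

noncomputable section

namespace RegMobius

/-! ### Entries of elements of `Sp(1,1)` -/

/-! Write `A` with rows `(a, c)` and `(b, d)`. Everything reduces to the single invariant `b d⁻¹` of
the second row, `rowQuot A`.

Bijectivity: multiplying regularly on the right by a linear function has a pointwise formula, so
`𝓕_A` can be evaluated in closed form. It is the classical transformation `q ↦ (qc + d)⁻¹(qa + b)`
precomposed with the conjugation `T(q) = w⁻¹qw`, `w = q c̄ + d̄` (`regMobius_eq`). Both factors
permute the ball: the first has an explicit inverse (`mobius_bijOn`), the second is inverted by the
same conjugation with `c, d` in place of `c̄, d̄` (`twist_bijOn`). A direct computation then shows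
that `𝓕_{A⁻¹}` vanishes at `b d⁻¹`, and by injectivity nowhere else in the ball.

Quotient: the double cosets are exactly the fibres of `b d⁻¹` (`proj_eq_proj_iff`), and `A ↦ b d⁻¹`
is a smooth map onto the ball with the smooth section `boostSection`. Hence `D` is homeomorphic to
the ball and inherits one global chart. Translates of the section pass through every point of the
group, which makes the projection a submersion. Uniqueness is formal: submersions have local smooth
sections, so smoothness of a map out of `D` can be tested after composing with the projection
(`IsSubmersion.contMDiff_of_comp`), and this applies to the identity between two natural structures.
-/

lemma conj_relations (A : Sp11) :
    star ((A : M₂) 0 0) * (A : M₂) 0 0 - star ((A : M₂) 1 0) * (A : M₂) 1 0 = 1 ∧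
    star ((A : M₂) 0 0) * (A : M₂) 0 1 = star ((A : M₂) 1 0) * (A : M₂) 1 1 ∧
    star ((A : M₂) 1 1) * (A : M₂) 1 1 - star ((A : M₂) 0 1) * (A : M₂) 0 1 = 1 := by
  have h := mem_Sp11.1 A.2
  have h00 := congrFun (congrFun h 0) 0
  have h01 := congrFun (congrFun h 0) 1
  have h11 := congrFun (congrFun h 1) 1
  simp [J, Matrix.mul_apply, Fin.sum_univ_two, Matrix.conjTranspose_apply] at h00 h01 h11
  refine ⟨?_, ?_, ?_⟩
  · rw [← h00]; abel
  · rw [← sub_eq_zero, ← h01]; abel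
  · rw [← neg_inj, ← h11]; abel

lemma coe_inv (A : Sp11) : ((A⁻¹ : Sp11) : M₂) =
    !![star ((A : M₂) 0 0), -star ((A : M₂) 1 0); -star ((A : M₂) 0 1), star ((A : M₂) 1 1)] := by
  change J * (A : M₂)ᴴ * J = _
  exact Matrix.ext fun i j => by
    fin_cases i <;> fin_cases j <;>
      simp [J, Matrix.mul_apply, Fin.sum_univ_two, Matrix.vecMul, dotProduct,
        Matrix.conjTranspose_apply]

/-- The group is closed under inverses, so these are the column relations of `A⁻¹`. -/
lemma row_relations (A : Sp11) :
    (A : M₂) 0 0 * star ((A : M₂) 0 0) - (A : M₂) 0 1 * star ((A : M₂) 0 1) = 1 ∧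
    (A : M₂) 0 0 * star ((A : M₂) 1 0) = (A : M₂) 0 1 * star ((A : M₂) 1 1) ∧
    (A : M₂) 1 1 * star ((A : M₂) 1 1) - (A : M₂) 1 0 * star ((A : M₂) 1 0) = 1 := by
  have h := conj_relations A⁻¹
  rw [coe_inv] at h
  simpa using h

lemma norm_sq_eq_of_mul_star {x y : ℍ[ℝ]} {r : ℝ} (h : x * star x - y * star y = (r : ℍ[ℝ])) :
    ‖x‖ ^ 2 - ‖y‖ ^ 2 = r := by
  rw [Quaternion.self_mul_star, Quaternion.self_mul_star, ← Quaternion.coe_sub,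
    Quaternion.coe_inj, Quaternion.normSq_eq_norm_mul_self, Quaternion.normSq_eq_norm_mul_self] at h
  linarith

lemma norm_sq_eq_of_star_mul {x y : ℍ[ℝ]} {r : ℝ} (h : star x * x - star y * y = (r : ℍ[ℝ])) :
    ‖x‖ ^ 2 - ‖y‖ ^ 2 = r := by
  rw [Quaternion.star_mul_self, Quaternion.star_mul_self, ← Quaternion.self_mul_star,
    ← Quaternion.self_mul_star] at h
  exact norm_sq_eq_of_mul_star h

lemma norm_relations (A : Sp11) :
    ‖(A : M₂) 0 0‖ ^ 2 - ‖(A : M₂) 0 1‖ ^ 2 = 1 ∧ ‖(A : M₂) 1 1‖ ^ 2 - ‖(A : M₂) 1 0‖ ^ 2 = 1 ∧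
    ‖(A : M₂) 1 1‖ ^ 2 - ‖(A : M₂) 0 1‖ ^ 2 = 1 :=
  ⟨norm_sq_eq_of_mul_star (by simpa using (row_relations A).1),
    norm_sq_eq_of_mul_star (by simpa using (row_relations A).2.2),
    norm_sq_eq_of_star_mul (by simpa using (conj_relations A).2.2)⟩

lemma norm_c_lt_norm_d (A : Sp11) : ‖(A : M₂) 0 1‖ < ‖(A : M₂) 1 1‖ := by
  have := (norm_relations A).2.2
  nlinarith [norm_nonneg ((A : M₂) 0 1), norm_nonneg ((A : M₂) 1 1)]

lemma norm_c_lt_norm_a (A : Sp11) : ‖(A : M₂) 0 1‖ < ‖(A : M₂) 0 0‖ := by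
  have := (norm_relations A).1
  nlinarith [norm_nonneg ((A : M₂) 0 1), norm_nonneg ((A : M₂) 0 0)]

lemma norm_b_lt_norm_d (A : Sp11) : ‖(A : M₂) 1 0‖ < ‖(A : M₂) 1 1‖ := by
  have := (norm_relations A).2.1
  nlinarith [norm_nonneg ((A : M₂) 1 0), norm_nonneg ((A : M₂) 1 1)]

lemma mem_ball_iff {q : ℍ[ℝ]} : q ∈ ball ↔ ‖q‖ < 1 := mem_ball_zero_iff

lemma add_ne_zero_of_norm_lt {x y : ℍ[ℝ]} (h : ‖x‖ < ‖y‖) : x + y ≠ 0 := by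
  intro h0
  rw [eq_neg_of_add_eq_zero_left h0, norm_neg] at h
  exact lt_irrefl _ h

lemma mul_add_ne_zero {q c d : ℍ[ℝ]} (hq : q ∈ ball) (h : ‖c‖ < ‖d‖) : q * c + d ≠ 0 := by
  refine add_ne_zero_of_norm_lt (lt_of_le_of_lt ?_ h)
  rw [norm_mul]
  exact mul_le_of_le_one_left (norm_nonneg _) (mem_ball_iff.1 hq).le

lemma add_mul_ne_zero {q c d : ℍ[ℝ]} (hq : q ∈ ball) (h : ‖c‖ < ‖d‖) : c * q + d ≠ 0 := by
  refine add_ne_zero_of_norm_lt (lt_of_le_of_lt ?_ h)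
  rw [norm_mul]
  exact mul_le_of_le_one_right (norm_nonneg _) (mem_ball_iff.1 hq).le

/-! ### The classical Möbius transformation -/

/-- The classical Möbius transformation `q ↦ (q c + d)⁻¹ (q a + b)`. -/
def mobius (A : Sp11) (q : ℍ[ℝ]) : ℍ[ℝ] :=
  (q * (A : M₂) 0 1 + (A : M₂) 1 1)⁻¹ * (q * (A : M₂) 0 0 + (A : M₂) 1 0)

/-- Invariance of the indefinite form gives `|qc + d|² - |qa + b|² = 1 - |q|²`, which is positive on
the ball. -/
lemma mobius_mapsTo (A : Sp11) : Set.MapsTo (mobius A) ball ball := by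
  intro q hq
  obtain ⟨h1, h2, h3⟩ := row_relations A
  have hden := mul_add_ne_zero hq (norm_c_lt_norm_d A)
  unfold mobius
  set a := (A : M₂) 0 0
  set b := (A : M₂) 1 0
  set c := (A : M₂) 0 1
  set d := (A : M₂) 1 1
  have h2' : b * star a = d * star c := by simpa using congrArg star h2
  have key : (q * c + d) * star (q * c + d) - (q * a + b) * star (q * a + b)
      = ((1 - ‖q‖ ^ 2 : ℝ) : ℍ[ℝ]) := by
    have hn : ((1 - ‖q‖ ^ 2 : ℝ) : ℍ[ℝ]) = 1 - q * star q := by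
      rw [Quaternion.self_mul_star, Quaternion.normSq_eq_norm_mul_self, ← sq]; simp
    rw [hn, star_add, star_add, star_mul, star_mul]
    calc (q * c + d) * (star c * star q + star d) - (q * a + b) * (star a * star q + star b)
        = -(q * (a * star a - c * star c) * star q) - q * (a * star b - c * star d)
          - (b * star a - d * star c) * star q + (d * star d - b * star b) := by noncomm_ring
      _ = 1 - q * star q := by rw [h1, h2, h2', h3]; noncomm_ring
  have := norm_sq_eq_of_mul_star key
  have hq' := mem_ball_iff.1 hq
  rw [SetLike.mem_coe, mem_ball_iff, norm_mul, norm_inv, inv_mul_lt_one₀ (norm_pos_iff.2 hden)]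
  refine lt_of_pow_lt_pow_left₀ 2 (norm_nonneg _) ?_
  nlinarith [norm_nonneg q]

/-- The inverse of the classical Möbius transformation. -/
def mobiusInv (A : Sp11) (y : ℍ[ℝ]) : ℍ[ℝ] :=
  ((A : M₂) 1 1 * y - (A : M₂) 1 0) * ((A : M₂) 0 0 - (A : M₂) 0 1 * y)⁻¹

lemma mobiusInv_den_ne_zero (A : Sp11) {y : ℍ[ℝ]} (hy : y ∈ ball) :
    (A : M₂) 0 0 - (A : M₂) 0 1 * y ≠ 0 := by
  have := add_mul_ne_zero (c := (A : M₂) 0 1) (d := -(A : M₂) 0 0) hy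
    (by rw [norm_neg]; exact norm_c_lt_norm_a A)
  intro h
  apply this
  rw [← neg_eq_zero, ← h]; abel

lemma mobiusInv_mapsTo (A : Sp11) : Set.MapsTo (mobiusInv A) ball ball := by
  intro q hq
  obtain ⟨h1, h2, h3⟩ := conj_relations A
  have hden := mobiusInv_den_ne_zero A hq
  unfold mobiusInv
  set a := (A : M₂) 0 0
  set b := (A : M₂) 1 0
  set c := (A : M₂) 0 1
  set d := (A : M₂) 1 1
  have h2' : star c * a = star d * b := by simpa using congrArg star h2
  have key : star (a - c * q) * (a - c * q) - star (d * q - b) * (d * q - b)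
      = ((1 - ‖q‖ ^ 2 : ℝ) : ℍ[ℝ]) := by
    have hn : ((1 - ‖q‖ ^ 2 : ℝ) : ℍ[ℝ]) = 1 - star q * q := by
      rw [Quaternion.star_mul_self, Quaternion.normSq_eq_norm_mul_self, ← sq]; simp
    rw [hn, star_sub, star_sub, star_mul, star_mul]
    calc (star a - star q * star c) * (a - c * q) - (star q * star d - star b) * (d * q - b)
        = (star a * a - star b * b) - star q * (star d * d - star c * c) * q
          - (star a * c - star b * d) * q - star q * (star c * a - star d * b) := by noncomm_ring
      _ = 1 - star q * q := by rw [h1, h2, h2', h3]; noncomm_ring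
  have := norm_sq_eq_of_star_mul key
  have hq' := mem_ball_iff.1 hq
  rw [SetLike.mem_coe, mem_ball_iff, norm_mul, norm_inv, mul_inv_lt_iff₀ (norm_pos_iff.2 hden),
    one_mul]
  refine lt_of_pow_lt_pow_left₀ 2 (norm_nonneg _) ?_
  nlinarith [norm_nonneg q]

/-- The equation `(qc + d)y = qa + b` is the same as `q(a - cy) = dy - b`; solving it for `y` or for
`q` gives the two mutually inverse maps. -/
lemma mobius_bijOn (A : Sp11) : Set.BijOn (mobius A) ball ball := by
  refine Set.InvOn.bijOn (f' := mobiusInv A) ⟨?_, ?_⟩ (mobius_mapsTo A) (mobiusInv_mapsTo A)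
  · intro q hq
    have h1 := mul_add_ne_zero hq (norm_c_lt_norm_d A)
    have h2 := mobiusInv_den_ne_zero A (mobius_mapsTo A hq)
    have h : (q * (A : M₂) 0 1 + (A : M₂) 1 1) * mobius A q
        = q * (A : M₂) 0 0 + (A : M₂) 1 0 := by rw [mobius, mul_inv_cancel_left₀ h1]
    rw [mobiusInv, mul_inv_eq_iff_eq_mul₀ h2, mul_sub, ← sub_eq_zero]
    rw [← sub_eq_zero] at h
    rw [← h]
    noncomm_ring
  · intro y hy
    have h1 := mobiusInv_den_ne_zero A hy
    have h2 := mul_add_ne_zero (mobiusInv_mapsTo A hy) (norm_c_lt_norm_d A)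
    have h : mobiusInv A y * ((A : M₂) 0 0 - (A : M₂) 0 1 * y)
        = (A : M₂) 1 1 * y - (A : M₂) 1 0 := by rw [mobiusInv, inv_mul_cancel_right₀ h1]
    rw [mobius, inv_mul_eq_iff_eq_mul₀ h2, ← sub_eq_zero]
    rw [← sub_eq_zero] at h
    rw [← h]
    noncomm_ring

/-! ### The conjugation relating regular and classical Möbius transformations -/

/-- The conjugation `q ↦ (q c + d)⁻¹ q (q c + d)`. -/
def twist (c d q : ℍ[ℝ]) : ℍ[ℝ] := (q * c + d)⁻¹ * (q * (q * c + d))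

/-- The symmetrization of `q ↦ q c + d`. -/
def symPoly (c d q : ℍ[ℝ]) : ℍ[ℝ] :=
  q * (q * (c * star c)) + q * (c * star d + d * star c) + d * star d

lemma commute_mul_star (c q : ℍ[ℝ]) : Commute q (c * star c) := by
  rw [Quaternion.self_mul_star]; exact (Quaternion.coe_commutes _ _).symm

lemma commute_mul_star_add (c d q : ℍ[ℝ]) : Commute q (c * star d + d * star c) := by
  have : c * star d + d * star c = ((2 * (c * star d).re : ℝ) : ℍ[ℝ]) := by
    rw [← Quaternion.self_add_star', star_mul, star_star]
  rw [this]; exact (Quaternion.coe_commutes _ _).symm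

/-- The coefficients of the symmetrization are real, hence central. -/
lemma commute_symPoly (c d q : ℍ[ℝ]) : Commute q (symPoly c d q) :=
  (((Commute.refl q).mul_right ((Commute.refl q).mul_right (commute_mul_star _ _))).add_right
    ((Commute.refl q).mul_right (commute_mul_star_add _ _ _))).add_right (commute_mul_star _ _)

/-- Pointwise form of `f^c * f = f^s` for `f = l_{(c,d)}`: right regular multiplication by `f` sends
a value `s` at `q` to `q s c + s d`. -/
lemma symPoly_eq (c d q : ℍ[ℝ]) :
    q * (q * star c + star d) * c + (q * star c + star d) * d = symPoly c d q := by
  have h : c * star d + d * star c = star d * c + star c * d := by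
    ext <;> simp <;> ring
  rw [symPoly, h, Quaternion.self_mul_star, Quaternion.self_mul_star, ← Quaternion.star_mul_self,
    ← Quaternion.star_mul_self]
  noncomm_ring

lemma twist_mapsTo {c d : ℍ[ℝ]} (h : ‖c‖ < ‖d‖) : Set.MapsTo (twist c d) ball ball := by
  intro q hq
  have h1 : ‖q * c + d‖ ≠ 0 := norm_ne_zero_iff.2 (mul_add_ne_zero hq h)
  rw [SetLike.mem_coe, mem_ball_iff] at *
  rwa [twist, norm_mul, norm_mul, norm_inv, mul_comm ‖q‖, inv_mul_cancel_left₀ h1]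

/-- With `w = q c̄ + d̄` and `T = w⁻¹qw`, the left side is `q w c + w d`. This factorization links
the regular reciprocal to the classical denominator evaluated at `T`. -/
lemma mul_twist_add {c d q : ℍ[ℝ]} (hq : q ∈ ball) (h : ‖c‖ < ‖d‖) :
    (q * star c + star d) * (twist (star c) (star d) q * c + d) = symPoly c d q := by
  have h1 := mul_add_ne_zero (c := star c) (d := star d) hq (by simpa using h)
  rw [← symPoly_eq, twist, mul_add, ← mul_assoc, mul_inv_cancel_left₀ h1]

lemma symPoly_ne_zero {c d q : ℍ[ℝ]} (hq : q ∈ ball) (h : ‖c‖ < ‖d‖) : symPoly c d q ≠ 0 := by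
  have h' : ‖star c‖ < ‖star d‖ := by simpa using h
  rw [← mul_twist_add hq h]
  exact mul_ne_zero (mul_add_ne_zero hq h') (mul_add_ne_zero (twist_mapsTo h' hq) h)

/-- The second conjugation is by `T c + d = w⁻¹ f^s(q)`: its factor `w⁻¹` undoes the first one, and
`f^s(q)` commutes with `q`. -/
lemma twist_twist_star {c d q : ℍ[ℝ]} (hq : q ∈ ball) (h : ‖c‖ < ‖d‖) :
    twist c d (twist (star c) (star d) q) = q := by
  have h' : ‖star c‖ < ‖star d‖ := by simpa using h
  have h1 := mul_add_ne_zero hq h'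
  have h2 := mul_add_ne_zero (twist_mapsTo h' hq) h
  have h3 : twist (star c) (star d) q * c + d = (q * star c + star d)⁻¹ * symPoly c d q := by
    rw [← mul_twist_add hq h, inv_mul_cancel_left₀ h1]
  rw [twist, inv_mul_eq_iff_eq_mul₀ h2, h3, mul_assoc _ _ q, ← (commute_symPoly c d q).eq]
  nth_rewrite 1 [twist]
  simp only [mul_assoc, mul_inv_cancel_left₀ h1]

lemma twist_bijOn {c d : ℍ[ℝ]} (h : ‖c‖ < ‖d‖) : Set.BijOn (twist c d) ball ball := by
  have h' : ‖star c‖ < ‖star d‖ := by simpa using h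
  refine Set.InvOn.bijOn (f' := twist (star c) (star d)) ⟨?_, ?_⟩ (twist_mapsTo h)
    (twist_mapsTo h')
  · intro q hq
    simpa using twist_twist_star hq h'
  · intro q hq
    exact twist_twist_star hq h

/-! ### Power series on the unit ball -/

/-- The restriction of `∑ qⁿ aₙ` to the real axis, as a formal series. -/
def realSeries (a : PowerSeries ℍ[ℝ]) : FormalMultilinearSeries ℝ ℝ ℍ[ℝ] :=
  fun n => ContinuousMultilinearMap.mkPiRing ℝ (Fin n) (PowerSeries.coeff n a)

lemma coeff_realSeries (a : PowerSeries ℍ[ℝ]) (n : ℕ) :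
    (realSeries a).coeff n = PowerSeries.coeff n a := by
  simp [realSeries, FormalMultilinearSeries.coeff]

/-- On the real axis the powers of `q` are real scalars, so uniqueness for power series in one real
variable applies. -/
lemma HasExpansion.unique {f : ℍ[ℝ] → ℍ[ℝ]} {a b : PowerSeries ℍ[ℝ]} (ha : HasExpansion f a)
    (hb : HasExpansion f b) : a = b := by
  have key : ∀ a : PowerSeries ℍ[ℝ], HasExpansion f a →
      HasFPowerSeriesAt (fun r : ℝ => f (r : ℍ[ℝ])) (realSeries a) 0 := by
    intro a ha
    rw [hasFPowerSeriesAt_iff]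
    filter_upwards [Metric.ball_mem_nhds (0 : ℝ) one_pos] with r hr
    have hr' : (r : ℍ[ℝ]) ∈ ball := by
      rw [mem_ball_iff, Quaternion.norm_coe]; simpa using hr
    have h := ha _ hr'
    simp only [← Quaternion.coe_pow, Quaternion.coe_mul_eq_smul] at h
    simpa only [coeff_realSeries, zero_add] using h
  have h := (key a ha).eq_formalMultilinearSeries (key b hb)
  ext1 n
  simpa only [coeff_realSeries] using congrArg (fun p => FormalMultilinearSeries.coeff p n) h

lemma HasExpansion.expansion_eq {f : ℍ[ℝ] → ℍ[ℝ]} {a : PowerSeries ℍ[ℝ]} (h : HasExpansion f a) :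
    expansion f = a := by
  have h' : ∃ a, HasExpansion f a := ⟨a, h⟩
  rw [expansion, dif_pos h']
  exact h'.choose_spec.unique h

/-- The power series `a` converges at `q`, to the value `s`. -/
def HasEval (q : ℍ[ℝ]) (a : PowerSeries ℍ[ℝ]) (s : ℍ[ℝ]) : Prop :=
  HasSum (fun n : ℕ => q ^ n * PowerSeries.coeff n a) s

lemma HasEval.evalSeries_eq {q s : ℍ[ℝ]} {a : PowerSeries ℍ[ℝ]} (h : HasEval q a s) :
    evalSeries a q = s := h.tsum_eq

lemma HasEval.add {q s t : ℍ[ℝ]} {a b : PowerSeries ℍ[ℝ]} (ha : HasEval q a s)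
    (hb : HasEval q b t) : HasEval q (a + b) (s + t) := by
  simpa only [HasEval, map_add, mul_add] using HasSum.add ha hb

lemma HasEval.mul_C {q s : ℍ[ℝ]} {a : PowerSeries ℍ[ℝ]} (ha : HasEval q a s) (x : ℍ[ℝ]) :
    HasEval q (a * PowerSeries.C x) (s * x) := by
  simpa only [HasEval, PowerSeries.coeff_mul_C, mul_assoc] using HasSum.mul_right x ha

lemma HasEval.X_mul {q s : ℍ[ℝ]} {a : PowerSeries ℍ[ℝ]} (ha : HasEval q a s) :
    HasEval q (PowerSeries.X * a) (q * s) := by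
  have h := HasSum.mul_left q ha
  rw [HasEval, ← hasSum_nat_add_iff' 1]
  simpa [PowerSeries.coeff_succ_X_mul, pow_succ', mul_assoc] using h

lemma hasEval_one (q : ℍ[ℝ]) : HasEval q 1 1 := by
  have h := hasSum_ite_eq (0 : ℕ) (1 : ℍ[ℝ])
  rw [HasEval]
  convert h using 2 with n
  rw [PowerSeries.coeff_one]
  split_ifs with hn <;> simp [hn]

lemma HasEval.unique {q s t : ℍ[ℝ]} {a : PowerSeries ℍ[ℝ]} (h : HasEval q a s)
    (h' : HasEval q a t) : s = t := HasSum.unique h h'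

/-- The power series with two terms. -/
def linSeries (a b : ℍ[ℝ]) : PowerSeries ℍ[ℝ] :=
  PowerSeries.X * PowerSeries.C a + PowerSeries.C b

/-- Every regular product needed here has a linear right factor, so this formula replaces any
general convergence theorem for Cauchy products. -/
lemma HasEval.mul_linSeries {q s : ℍ[ℝ]} {a : PowerSeries ℍ[ℝ]} (h : HasEval q a s) (x y : ℍ[ℝ]) :
    HasEval q (a * linSeries x y) (q * s * x + s * y) := by
  have h1 := (h.mul_C x).X_mul.add (h.mul_C y)
  rw [linSeries, mul_add, ← mul_assoc, ← PowerSeries.X_mul]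
  simpa only [mul_assoc] using h1

lemma hasExpansion_lin (a b : ℍ[ℝ]) : HasExpansion (lin a b) (linSeries a b) := by
  intro q _
  simpa [lin, HasEval] using (hasEval_one q).mul_linSeries a b

lemma expansion_lin (a b : ℍ[ℝ]) : expansion (lin a b) = linSeries a b :=
  (hasExpansion_lin a b).expansion_eq

lemma regConj_lin (c d : ℍ[ℝ]) : regConj (lin c d) = lin (star c) (star d) := by
  have h : (PowerSeries.mk fun n => star (PowerSeries.coeff n (expansion (lin c d))))
      = linSeries (star c) (star d) := by
    rw [expansion_lin]
    ext1 n
    rcases n with _ | n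
    · simp [linSeries]
    · simp only [PowerSeries.coeff_mk, linSeries, map_add, PowerSeries.coeff_succ_X_mul,
        PowerSeries.coeff_C, star_add, apply_ite star, star_zero]
  funext q
  rw [regConj, h]
  have := ((hasEval_one q).mul_linSeries (star c) (star d)).evalSeries_eq
  simpa [lin] using this

lemma symmetrization_lin (c d : ℍ[ℝ]) : symmetrization (lin c d) = symPoly c d := by
  funext q
  rw [symmetrization, regConj_lin, starMul, expansion_lin, expansion_lin]
  have h := ((hasEval_one q).mul_linSeries c d).mul_linSeries (star c) (star d)
  rw [one_mul] at h
  rw [h.evalSeries_eq, symPoly]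
  noncomm_ring

/-- The power series of the regular reciprocal of `q ↦ q c + d`. -/
def linInvSeries (c d : ℍ[ℝ]) : PowerSeries ℍ[ℝ] :=
  PowerSeries.mk fun n => (-(d⁻¹ * c)) ^ n * d⁻¹

lemma linInvSeries_mul_linSeries {c d : ℍ[ℝ]} (hd : d ≠ 0) :
    linInvSeries c d * linSeries c d = 1 := by
  rw [linSeries, mul_add, ← mul_assoc, ← PowerSeries.X_mul, mul_assoc]
  ext1 n
  rcases n with _ | n
  · simp [linInvSeries, hd]
  · rw [map_add, PowerSeries.coeff_succ_X_mul, PowerSeries.coeff_mul_C, PowerSeries.coeff_mul_C,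
      linInvSeries, PowerSeries.coeff_mk, PowerSeries.coeff_mk, inv_mul_cancel_right₀ hd, pow_succ,
      mul_assoc]
    simp [PowerSeries.coeff_one]

lemma exists_hasEval_linInvSeries {c d q : ℍ[ℝ]} (hq : q ∈ ball) (h : ‖c‖ < ‖d‖) :
    ∃ s, HasEval q (linInvSeries c d) s := by
  have hd : 0 < ‖d‖ := (norm_nonneg c).trans_lt h
  have hr : ‖q‖ * ‖d⁻¹ * c‖ < 1 := by
    rw [norm_mul, norm_inv]
    have h1 : ‖d‖⁻¹ * ‖c‖ < 1 := by rwa [inv_mul_lt_one₀ hd]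
    have h2 := mem_ball_iff.1 hq
    have h3 : 0 ≤ ‖d‖⁻¹ * ‖c‖ := by positivity
    nlinarith [norm_nonneg q]
  have hs : Summable fun n : ℕ => q ^ n * PowerSeries.coeff n (linInvSeries c d) := by
    refine Summable.of_norm_bounded
      ((summable_geometric_of_lt_one (by positivity) hr).mul_right ‖d⁻¹‖) fun n => ?_
    simp [linInvSeries, mul_pow, mul_assoc]
  exact ⟨_, hs.hasSum⟩

/-- If `δ = s - t` were nonzero, then `δ d = -q δ c` would contradict `|q| |c| < |d|`. -/
lemma sylvester_unique {c d q s t : ℍ[ℝ]} (hq : q ∈ ball) (h : ‖c‖ < ‖d‖)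
    (hst : q * s * c + s * d = q * t * c + t * d) : s = t := by
  by_contra hne
  have h0 : 0 < ‖s - t‖ := norm_pos_iff.2 (sub_ne_zero.2 hne)
  have h1 : (s - t) * d = -(q * (s - t) * c) := by
    rw [← sub_eq_zero] at hst ⊢
    rw [← hst]; noncomm_ring
  have h2 := congrArg norm h1
  rw [norm_neg, norm_mul, norm_mul, norm_mul] at h2
  have hq' := mem_ball_iff.1 hq
  have h3 : ‖q‖ * ‖s - t‖ * ‖c‖ ≤ ‖s - t‖ * ‖c‖ := by
    gcongr
    exact mul_le_of_le_one_left h0.le hq'.le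
  have h4 : ‖s - t‖ * ‖c‖ < ‖s - t‖ * ‖d‖ := by gcongr
  linarith

/-- The sum of the geometric series and the closed form `(f^s)⁻¹ f^c` both solve `q s c + s d = 1`,
so they agree. This identifies the expansion of the regular reciprocal. -/
lemma hasEval_linInvSeries {c d q : ℍ[ℝ]} (hq : q ∈ ball) (h : ‖c‖ < ‖d‖) :
    HasEval q (linInvSeries c d) (regInv (lin c d) q) := by
  have hd : d ≠ 0 := norm_pos_iff.1 ((norm_nonneg c).trans_lt h)
  obtain ⟨s, hs⟩ := exists_hasEval_linInvSeries hq h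
  have h1 := hs.mul_linSeries c d
  rw [linInvSeries_mul_linSeries hd] at h1
  have h2 := h1.unique (hasEval_one q)
  have hP := symPoly_ne_zero hq h
  have h3 : s = regInv (lin c d) q := by
    refine sylvester_unique hq h (h2.trans ?_)
    rw [regInv, symmetrization_lin, regConj_lin, lin]
    calc (1 : ℍ[ℝ]) = (symPoly c d q)⁻¹ * (q * (q * star c + star d) * c
          + (q * star c + star d) * d) := by rw [symPoly_eq, inv_mul_cancel₀ hP]
      _ = _ := by
        rw [← mul_assoc q, (commute_symPoly c d q).inv_right₀.eq]
        noncomm_ring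
  exact h3 ▸ hs

/-- A regular Möbius transformation is a classical one composed with a conjugation. -/
lemma regMobius_eq (A : Sp11) {q : ℍ[ℝ]} (hq : q ∈ ball) :
    regMobius A q = mobius A (twist (star ((A : M₂) 0 1)) (star ((A : M₂) 1 1)) q) := by
  have hcd := norm_c_lt_norm_d A
  unfold regMobius mobius
  set a := (A : M₂) 0 0
  set b := (A : M₂) 1 0
  set c := (A : M₂) 0 1
  set d := (A : M₂) 1 1
  have hexp : expansion (regInv (lin c d)) = linInvSeries c d :=
    HasExpansion.expansion_eq fun p hp => hasEval_linInvSeries hp hcd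
  -- The value is `q s a + s b` with `s = (f^s)⁻¹ w`. Moving `(f^s)⁻¹` past `q`, substituting `f^s =
  -- w(T c + d)` and using `q w = w T` cancels `w`.
  rw [starMul, hexp, expansion_lin, ((hasEval_linInvSeries hq hcd).mul_linSeries a b).evalSeries_eq,
    regInv, symmetrization_lin, regConj_lin, lin, ← mul_assoc q,
    (commute_symPoly c d q).inv_right₀.eq, ← mul_twist_add hq hcd]
  have hcd' : ‖star c‖ < ‖star d‖ := by simpa using hcd
  have h1 := mul_add_ne_zero hq hcd'
  rw [mul_inv_rev]
  have h2 : q * (q * star c + star d)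
      = (q * star c + star d) * twist (star c) (star d) q := by
    rw [twist, mul_inv_cancel_left₀ h1]
  simp only [mul_assoc]
  rw [← mul_assoc q, h2, mul_assoc, inv_mul_cancel_left₀ h1, inv_mul_cancel_left₀ h1, mul_add]

lemma regMobius_bijOn (A : Sp11) : Set.BijOn (regMobius A) ball ball :=
  ((mobius_bijOn A).comp (twist_bijOn (by simpa using norm_c_lt_norm_d A))).congr
    fun _ hq => (regMobius_eq A hq).symm

/-- The quotient `b d⁻¹` of the entries of the second row. -/
def rowQuot (A : Sp11) : ℍ[ℝ] := (A : M₂) 1 0 * ((A : M₂) 1 1)⁻¹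

lemma d_ne_zero (A : Sp11) : (A : M₂) 1 1 ≠ 0 :=
  norm_pos_iff.1 ((norm_nonneg _).trans_lt (norm_b_lt_norm_d A))

lemma rowQuot_mem_ball (A : Sp11) : rowQuot A ∈ ball := by
  rw [mem_ball_iff, rowQuot, norm_mul, norm_inv, ← div_eq_mul_inv,
    div_lt_one (norm_pos_iff.2 (d_ne_zero A))]
  exact norm_b_lt_norm_d A

lemma regMobius_inv_rowQuot (A : Sp11) : regMobius A⁻¹ (rowQuot A) = 0 := by
  rw [regMobius_eq _ (rowQuot_mem_ball A)]
  have h2 := (row_relations A).2.1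
  have hd := d_ne_zero A
  simp only [mobius, rowQuot, coe_inv, Matrix.of_apply, Matrix.cons_val', Matrix.cons_val_zero,
    Matrix.cons_val_one, Matrix.cons_val_fin_one, star_neg, star_star]
  set a := (A : M₂) 0 0
  set b := (A : M₂) 1 0
  set c := (A : M₂) 0 1
  set d := (A : M₂) 1 1
  have h2' : b * star a = d * star c := by simpa using congrArg star h2
  -- With `w = d - b d⁻¹ b`, both `b d⁻¹ w` and `w d⁻¹ b` equal `b - b d⁻¹ b d⁻¹ b`.
  have hT : twist (-b) d (b * d⁻¹) = d⁻¹ * b := by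
    have hw : b * d⁻¹ * -b + d ≠ 0 :=
      mul_add_ne_zero (rowQuot_mem_ball A) (by rw [norm_neg]; exact norm_b_lt_norm_d A)
    rw [twist, inv_mul_eq_iff_eq_mul₀ hw, mul_add, add_mul, mul_inv_cancel_left₀ hd,
      inv_mul_cancel_right₀ hd]
    noncomm_ring
  rw [hT, mul_assoc d⁻¹ b (star a), h2', inv_mul_cancel_left₀ hd, add_neg_cancel, mul_zero]

lemma setOf_regMobius_inv_eq_zero (A : Sp11) :
    {q : ℍ[ℝ] | q ∈ ball ∧ regMobius A⁻¹ q = 0} = {rowQuot A} := by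
  ext q
  rw [Set.mem_ofPred_eq, Set.mem_singleton_iff]
  constructor
  · rintro ⟨hq, h0⟩
    exact (regMobius_bijOn A⁻¹).injOn hq (rowQuot_mem_ball A)
      (h0.trans (regMobius_inv_rowQuot A).symm)
  · rintro rfl
    exact ⟨rowQuot_mem_ball A, regMobius_inv_rowQuot A⟩

/-! ### Smooth maps from and to `Sp(1,1)` -/

lemma contMDiff_coe_Sp11 : ContMDiff 𝓘(ℝ, sp11) 𝓘(ℝ, M₂) ∞ (fun A : Sp11 => (A : M₂)) := by
  intro A
  have he : IsSubmanifoldChart (chartAt sp11 A) := chart_mem_atlas sp11 A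
  have hA := mem_chart_source sp11 A
  have h1 : ContDiffAt ℝ ∞ (fun Y => (((chartAt sp11 A).symm Y : Sp11) : M₂))
      (chartAt sp11 A A) :=
    he.1.contDiffAt ((chartAt sp11 A).open_target.mem_nhds ((chartAt sp11 A).map_source hA))
  have h2 : ContMDiffAt 𝓘(ℝ, sp11) 𝓘(ℝ, sp11) ∞ (chartAt sp11 A) A :=
    contMDiffOn_chart.contMDiffAt ((chartAt sp11 A).open_source.mem_nhds hA)
  refine (h1.contMDiffAt.comp A h2).congr_of_eventuallyEq ?_
  filter_upwards [(chartAt sp11 A).open_source.mem_nhds hA] with B hB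
  simp [(chartAt sp11 A).left_inv hB]

section

variable {E F G H : Type*} [NormedAddCommGroup E] [NormedSpace ℝ E] [NormedAddCommGroup F]
  [NormedSpace ℝ F] [NormedAddCommGroup G] [NormedSpace ℝ G] [TopologicalSpace H]
  {I : ModelWithCorners ℝ G H}
  {M N P : Type*} [TopologicalSpace M] [TopologicalSpace N] [TopologicalSpace P]
  [ChartedSpace E M] [ChartedSpace F N] [ChartedSpace H P]

/-- Universal property of the embedded submanifold: near each point a chart is the restriction of a
smooth map on all matrices, which can be composed with `f`. -/
lemma contMDiff_of_coe_Sp11 {f : P → Sp11}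
    (h : ContMDiff I 𝓘(ℝ, M₂) ∞ (fun x => (f x : M₂))) : ContMDiff I 𝓘(ℝ, sp11) ∞ f := by
  intro x
  have hc : ContinuousAt f x := by
    rw [Topology.IsInducing.subtypeVal.continuousAt_iff]
    exact (h x).continuousAt
  rw [contMDiffAt_iff_target]
  refine ⟨hc, ?_⟩
  have he : IsSubmanifoldChart (chartAt sp11 (f x)) := chart_mem_atlas sp11 (f x)
  obtain ⟨g, hg, hge⟩ := he.2 (f x) (mem_chart_source sp11 (f x))
  refine (hg.contMDiffAt.comp x (h x)).congr_of_eventuallyEq ?_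
  filter_upwards [hc.eventually hge] with y hy
  simp [hy]

/-! ### Local sections of submersions -/

/-- Restrict `f` to the affine slice `a + R v`, with `R` a linear right inverse of the derivative.
The restriction has derivative the identity at `0`, so the inverse function theorem applies. -/
lemma exists_local_rightInverse [CompleteSpace E] [FiniteDimensional ℝ F] {f : E → F} {a : E}
    (hf : ContDiffAt ℝ ∞ f a) (hsurj : Function.Surjective (fderiv ℝ f a)) :
    ∃ s : F → E, ContDiffAt ℝ ∞ s (f a) ∧ s (f a) = a ∧ ∀ᶠ y in 𝓝 (f a), f (s y) = y := by
  have := FiniteDimensional.complete ℝ F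
  obtain ⟨r, hr⟩ := (fderiv ℝ f a).toLinearMap.exists_rightInverse_of_surjective
    (LinearMap.range_eq_top.2 hsurj)
  set R : F →L[ℝ] E := LinearMap.toContinuousLinearMap r
  set g : F → E := fun v => a + R v
  have hg : ContDiff ℝ ∞ g := contDiff_const.add R.contDiff
  have hg0 : g 0 = a := by simp [g]
  have hf0 : ContDiffAt ℝ ∞ f (g 0) := by rwa [hg0]
  have hh : ContDiffAt ℝ ∞ (f ∘ g) 0 := hf0.comp 0 hg.contDiffAt
  have hg' : HasFDerivAt g R 0 := R.hasFDerivAt.const_add a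
  have hf' : HasFDerivAt f (fderiv ℝ f a) (g 0) := by
    rw [hg0]; exact (hf.differentiableAt (by simp)).hasFDerivAt
  have hh' : HasFDerivAt (f ∘ g) ((ContinuousLinearEquiv.refl ℝ F : F ≃L[ℝ] F) : F →L[ℝ] F) 0 := by
    have h := hf'.comp 0 hg'
    have e : (fderiv ℝ f a).comp R = ((ContinuousLinearEquiv.refl ℝ F : F ≃L[ℝ] F) : F →L[ℝ] F) :=
      ContinuousLinearMap.ext fun v => LinearMap.congr_fun hr v
    rwa [e] at h
  have hn : (∞ : ℕ∞ω) ≠ 0 := by simp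
  have h0 : (f ∘ g) 0 = f a := by rw [Function.comp_apply, hg0]
  refine ⟨g ∘ hh.localInverse hh' hn, ?_, ?_, ?_⟩
  · rw [← h0]
    exact hg.contDiffAt.comp _ (hh.to_localInverse hh' hn)
  · rw [← h0, Function.comp_apply, hh.localInverse_apply_image hh' hn, hg0]
  · rw [← h0]
    exact (hh.hasStrictFDerivAt' hh' hn).eventually_right_inverse

lemma exists_local_section [CompleteSpace E] [FiniteDimensional ℝ F]
    [IsManifold 𝓘(ℝ, E) ∞ M] [IsManifold 𝓘(ℝ, F) ∞ N] {p : M → N} {x : M}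
    (hp : ContMDiffAt 𝓘(ℝ, E) 𝓘(ℝ, F) ∞ p x)
    (hsurj : Function.Surjective (mfderiv 𝓘(ℝ, E) 𝓘(ℝ, F) p x)) :
    ∃ s : N → M, ContMDiffAt 𝓘(ℝ, F) 𝓘(ℝ, E) ∞ s (p x) ∧ s (p x) = x ∧
      ∀ᶠ y in 𝓝 (p x), p (s y) = y := by
  have hd : MDifferentiableAt 𝓘(ℝ, E) 𝓘(ℝ, F) p x := hp.mdifferentiableAt (by simp)
  set φ := extChartAt 𝓘(ℝ, E) x with hφ
  set χ := extChartAt 𝓘(ℝ, F) (p x) with hχ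
  set f : E → F := χ ∘ p ∘ φ.symm with hfdef
  have hf : ContDiffAt ℝ ∞ f (φ x) := by
    have := (contMDiffAt_iff.1 hp).2
    simpa [f, φ, χ, contDiffWithinAt_univ] using this
  have hder : Function.Surjective (fderiv ℝ f (φ x)) := by
    have := hd.mfderiv
    rw [this] at hsurj
    simp only [writtenInExtChartAt, modelWithCornersSelf_coe, Set.range_id,
      fderivWithin_univ] at hsurj
    exact hsurj
  obtain ⟨s, hs, hsa, hse⟩ := exists_local_rightInverse hf hder
  have hfx : f (φ x) = χ (p x) := by simp [f, φ]
  rw [hfx] at hs hsa hse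
  have hs' : ContMDiffAt 𝓘(ℝ, F) 𝓘(ℝ, E) ∞ (φ.symm ∘ s ∘ χ) (p x) := by
    have h1 : ContMDiffAt 𝓘(ℝ, F) 𝓘(ℝ, F) ∞ χ (p x) := contMDiffAt_extChartAt
    have h2 : ContMDiffAt 𝓘(ℝ, E) 𝓘(ℝ, E) ∞ φ.symm (s (χ (p x))) := by
      rw [hsa]
      exact (contMDiffOn_extChartAt_symm x).contMDiffAt (extChartAt_target_mem_nhds x)
    exact h2.comp (p x) (hs.contMDiffAt.comp (p x) h1)
  have hs'x : (φ.symm ∘ s ∘ χ) (p x) = x := by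
    simp [hsa, φ]
  refine ⟨φ.symm ∘ s ∘ χ, hs', hs'x, ?_⟩
  have hc : ContinuousAt (p ∘ (φ.symm ∘ s ∘ χ)) (p x) :=
    ContinuousAt.comp (by rw [hs'x]; exact hp.continuousAt) hs'.continuousAt
  -- The section identity is known only in coordinates; it transfers to the manifold where both
  -- sides lie in the domain on which `χ` is injective.
  have hmem : ∀ᶠ y in 𝓝 (p x), p ((φ.symm ∘ s ∘ χ) y) ∈ χ.source := by
    refine hc.eventually_mem ?_
    rw [Function.comp_apply, hs'x]
    exact extChartAt_source_mem_nhds (p x)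
  filter_upwards [hmem, extChartAt_source_mem_nhds (I := 𝓘(ℝ, F)) (p x),
    (continuousAt_extChartAt (I := 𝓘(ℝ, F)) (p x)).eventually hse] with y h1 h2 h3
  exact χ.injOn h1 h2 h3

/-- A map out of the target of a submersion is smooth if its composite with the submersion is. -/
lemma IsSubmersion.contMDiff_of_comp [CompleteSpace E] [FiniteDimensional ℝ F]
    [IsManifold 𝓘(ℝ, E) ∞ M] [IsManifold 𝓘(ℝ, F) ∞ N] {p : M → N} {g : N → P}
    (hp : IsSubmersion 𝓘(ℝ, E) 𝓘(ℝ, F) p) (hg : ContMDiff 𝓘(ℝ, E) I ∞ (g ∘ p)) :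
    ContMDiff 𝓘(ℝ, F) I ∞ g := by
  intro y
  obtain ⟨x, rfl⟩ := hp.surjective y
  obtain ⟨s, hs, hsx, hse⟩ := exists_local_section (hp.contMDiff x) (hp.mfderiv_surjective x)
  have h : ContMDiffAt 𝓘(ℝ, F) I ∞ ((g ∘ p) ∘ s) (p x) :=
    ContMDiffAt.comp (p x) (hg _) hs
  refine h.congr_of_eventuallyEq ?_
  filter_upwards [hse] with y hy
  simp [hy]

end

/-! ### The double cosets are the fibres of `rowQuot` -/

/-- The scalar matrix of a unit quaternion. -/
def scalarUnit (v : ℍ[ℝ]) (hv : ‖v‖ = 1) : Sp11 :=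
  ⟨!![v, 0; 0, v], by
    have h : star v * v = 1 := by
      rw [Quaternion.star_mul_self, Quaternion.normSq_eq_norm_mul_self, hv]; simp
    rw [mem_Sp11]
    exact Matrix.ext fun i j => by
      fin_cases i <;> fin_cases j <;>
        simp [J, Matrix.mul_apply, Fin.sum_univ_two, Matrix.conjTranspose_apply, h]⟩

/-- From `|d|² - |c|² = 1` follows `c = 0`, and then `|a|² - |c|² = 1` gives `|a| = 1`. -/
lemma mem_leftSubgroup_of_row {A : Sp11} (h0 : (A : M₂) 1 0 = 0) (h1 : (A : M₂) 1 1 = 1) :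
    A ∈ leftSubgroup := by
  obtain ⟨n1, -, n3⟩ := norm_relations A
  rw [h1, norm_one] at n3
  have hc : (A : M₂) 0 1 = 0 := by
    rw [← norm_eq_zero, ← sq_eq_zero_iff]; linarith
  rw [hc, norm_zero] at n1
  refine ⟨(A : M₂) 0 0, ?_, ?_⟩
  · rw [← sq_eq_sq₀ (norm_nonneg _) zero_le_one]; linarith
  · exact Matrix.ext fun i j => by fin_cases i <;> fin_cases j <;> simp [h0, h1, hc]

lemma norm_d_sq_mul (A : Sp11) : ‖(A : M₂) 1 1‖ ^ 2 * (1 - ‖rowQuot A‖ ^ 2) = 1 := by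
  have h := (norm_relations A).2.1
  have hd := norm_ne_zero_iff.2 (d_ne_zero A)
  rw [rowQuot, norm_mul, norm_inv]
  field_simp
  linarith

/-- The left factor does not touch the second row, and the right factor cancels in `b d⁻¹`.
Conversely, `b d⁻¹` fixes `|d|`, hence the second row up to a unit scalar on the right; the second
row fixes the matrix up to the left subgroup. -/
lemma proj_eq_proj_iff {A B : Sp11} : proj A = proj B ↔ rowQuot A = rowQuot B := by
  rw [proj, proj, DoubleCoset.eq]
  constructor
  · rintro ⟨h, ⟨u, hu, hh⟩, k, ⟨v, hv, hk⟩, rfl⟩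
    have hv0 : v ≠ 0 := norm_ne_zero_iff.1 (by rw [hv]; exact one_ne_zero)
    simp [rowQuot, Submonoid.coe_mul, hh, hk, Matrix.mul_apply, Fin.sum_univ_two, mul_assoc, hv0]
  · intro h
    have hA := norm_d_sq_mul A
    have hB := norm_d_sq_mul B
    rw [← h] at hB
    have hdA := d_ne_zero A
    have hdB := d_ne_zero B
    have hd : ‖(A : M₂) 1 1‖ = ‖(B : M₂) 1 1‖ := by
      rw [← sq_eq_sq₀ (norm_nonneg _) (norm_nonneg _)]
      exact mul_right_cancel₀ (right_ne_zero_of_mul_eq_one hA) (hA.trans hB.symm)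
    have hv : ‖((A : M₂) 1 1)⁻¹ * (B : M₂) 1 1‖ = 1 := by
      rw [norm_mul, norm_inv, hd, inv_mul_cancel₀ (norm_ne_zero_iff.2 hdB)]
    -- The scalar `d_A⁻¹ d_B` is chosen so that `A k` and `B` have the same second row.
    set k := scalarUnit _ hv with hk
    have h0 : ((A * k : Sp11) : M₂) 1 0 = (B : M₂) 1 0 := by
      rw [rowQuot, rowQuot, eq_mul_inv_iff_mul_eq₀ hdB] at h
      simp [hk, scalarUnit, Submonoid.coe_mul, Matrix.mul_apply, Fin.sum_univ_two, ← h, mul_assoc]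
    have h1 : ((A * k : Sp11) : M₂) 1 1 = (B : M₂) 1 1 := by
      simp [hk, scalarUnit, Submonoid.coe_mul, Matrix.mul_apply, Fin.sum_univ_two, hdA]
    have hrow : ∀ j, ((B * (A * k)⁻¹ : Sp11) : M₂) 1 j = (1 : M₂) 1 j := by
      intro j
      rw [← coe_mul_inv (A * k), Submonoid.coe_mul, Matrix.mul_apply, Matrix.mul_apply,
        Fin.sum_univ_two, Fin.sum_univ_two, h0, h1]
    refine ⟨B * (A * k)⁻¹, mem_leftSubgroup_of_row ?_ ?_, k, ⟨_, hv, rfl⟩, ?_⟩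
    · rw [hrow]; simp
    · rw [hrow]; simp
    · rw [mul_assoc, inv_mul_cancel_right]

/-! ### A smooth section -/

/-- The map `A ↦ b d⁻¹` to the ball. -/
def toBall (A : Sp11) : ball := ⟨rowQuot A, rowQuot_mem_ball A⟩

/-- The linear map `t ↦ !![0, t̄; t, 0]`. -/
def offDiag : ℍ[ℝ] →ₗ[ℝ] M₂ where
  toFun t := !![0, star t; t, 0]
  map_add' s t := Matrix.ext fun i j => by fin_cases i <;> fin_cases j <;> simp
  map_smul' r t := Matrix.ext fun i j => by fin_cases i <;> fin_cases j <;> simp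

/-- The matrix `(1 - |t|²)^{-1/2} !![1, t̄; t, 1]`. -/
def boost (t : ℍ[ℝ]) : M₂ := (Real.sqrt (1 - ‖t‖ ^ 2))⁻¹ • (1 + offDiag t)

lemma one_sub_norm_sq_pos {t : ℍ[ℝ]} (ht : t ∈ ball) : 0 < 1 - ‖t‖ ^ 2 := by
  have := mem_ball_iff.1 ht
  nlinarith [norm_nonneg t]

lemma boost_mem {t : ℍ[ℝ]} (ht : t ∈ ball) : boost t ∈ Sp11 := by
  have hpos := one_sub_norm_sq_pos ht
  set r := (Real.sqrt (1 - ‖t‖ ^ 2))⁻¹ with hr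
  have hr2 : r * r * (1 - ‖t‖ ^ 2) = 1 := by
    rw [hr, ← mul_inv, Real.mul_self_sqrt hpos.le, inv_mul_cancel₀ hpos.ne']
  have hN : (1 + offDiag t)ᴴ * J * (1 + offDiag t) = (1 - ‖t‖ ^ 2) • J := by
    have h1 : star t * t = ((‖t‖ ^ 2 : ℝ) : ℍ[ℝ]) := by
      rw [Quaternion.star_mul_self, Quaternion.normSq_eq_norm_mul_self, sq]
    have h2 : t * star t = ((‖t‖ ^ 2 : ℝ) : ℍ[ℝ]) := by
      rw [Quaternion.self_mul_star, Quaternion.normSq_eq_norm_mul_self, sq]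
    have h3 : (1 - ‖t‖ ^ 2) • (1 : ℍ[ℝ]) = 1 - ((‖t‖ ^ 2 : ℝ) : ℍ[ℝ]) := by
      rw [sub_smul, one_smul, ← Quaternion.coe_mul_eq_smul, mul_one]
    exact Matrix.ext fun i j => by
      fin_cases i <;> fin_cases j <;>
        simp only [offDiag, J, Matrix.mul_apply, Fin.sum_univ_two, Matrix.conjTranspose_apply,
          Matrix.add_apply, Matrix.smul_apply, LinearMap.coe_mk, AddHom.coe_mk, Matrix.of_apply,
          Matrix.cons_val', Matrix.cons_val_zero, Matrix.cons_val_one, Matrix.cons_val_fin_one,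
          Fin.zero_eta, Fin.mk_one, smul_zero, smul_neg, h3, ← h1] <;>
        simp [h1, h2]
      <;> abel
  have hs : ∀ X : M₂, (r • X)ᴴ = r • Xᴴ := fun X =>
    Matrix.ext fun i j => by simp [Matrix.conjTranspose_apply]
  rw [mem_Sp11, boost, ← hr, hs, smul_mul_assoc, smul_mul_assoc, mul_smul_comm, hN, smul_smul,
    smul_smul, hr2, one_smul]

/-- A section of `toBall`. -/
def boostSection (t : ball) : Sp11 := ⟨boost t, boost_mem t.2⟩

lemma toBall_boostSection (t : ball) : toBall (boostSection t) = t := by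
  have hpos := one_sub_norm_sq_pos t.2
  have hr : (Real.sqrt (1 - ‖(t : ℍ[ℝ])‖ ^ 2))⁻¹ ≠ 0 := (inv_pos.2 (Real.sqrt_pos.2 hpos)).ne'
  apply Subtype.ext
  change boost t 1 0 * (boost t 1 1)⁻¹ = t
  have h0 : boost t 1 0 = (Real.sqrt (1 - ‖(t : ℍ[ℝ])‖ ^ 2))⁻¹ • (t : ℍ[ℝ]) := by
    simp [boost, offDiag]
  have h1 : boost t 1 1 = (((Real.sqrt (1 - ‖(t : ℍ[ℝ])‖ ^ 2))⁻¹ : ℝ) : ℍ[ℝ]) := by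
    simp [boost, offDiag, ← Quaternion.coe_mul_eq_smul]
  rw [h0, h1, ← Quaternion.mul_coe_eq_smul, mul_inv_cancel_right₀]
  exact fun h => hr (Quaternion.coe_inj.1 (h.trans Quaternion.coe_zero.symm))

lemma contMDiff_boostSection : ContMDiff 𝓘(ℝ, ℍ[ℝ]) 𝓘(ℝ, sp11) ∞ boostSection := by
  apply contMDiff_of_coe_Sp11
  intro t
  have hpos := one_sub_norm_sq_pos t.2
  have h1 : ContDiffAt ℝ ∞ (fun q : ℍ[ℝ] => 1 - ‖q‖ ^ 2) (t : ℍ[ℝ]) :=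
    contDiffAt_const.sub (contDiff_norm_sq ℝ).contDiffAt
  have h2 : ContDiffAt ℝ ∞ boost (t : ℍ[ℝ]) :=
    ((h1.sqrt hpos.ne').inv (Real.sqrt_pos.2 hpos).ne').smul
      (contDiffAt_const.add (LinearMap.toContinuousLinearMap offDiag).contDiff.contDiffAt)
  exact h2.contMDiffAt.comp t (contMDiff_subtype_val t)

lemma contDiff_entry (i j : Fin 2) : ContDiff ℝ ∞ (fun X : M₂ => X i j) :=
  (LinearMap.toContinuousLinearMap (Matrix.entryLinearMap ℝ ℍ[ℝ] i j : M₂ →ₗ[ℝ] ℍ[ℝ])).contDiff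

lemma contMDiff_toBall : ContMDiff 𝓘(ℝ, sp11) 𝓘(ℝ, ℍ[ℝ]) ∞ toBall := by
  rw [← ContMDiff.subtypeVal_comp_iff]
  intro A
  have h1 : ContDiffAt ℝ ∞ (Ring.inverse : ℍ[ℝ] → ℍ[ℝ]) ((A : M₂) 1 1) :=
    contDiffAt_ringInverse ℝ (Units.mk0 _ (d_ne_zero A))
  have h2 : ContDiffAt ℝ ∞ (fun X : M₂ => X 1 0 * Ring.inverse (X 1 1)) (A : M₂) :=
    (contDiff_entry 1 0).contDiffAt.mul (ContDiffAt.comp (g := Ring.inverse)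
      (f := fun X : M₂ => X 1 1) (A : M₂) h1 (contDiff_entry 1 1).contDiffAt)
  refine (h2.contMDiffAt.comp A (contMDiff_coe_Sp11 A)).congr_of_eventuallyEq
    (Filter.Eventually.of_forall fun B => ?_)
  simp [toBall, rowQuot, Ring.inverse_eq_inv']

lemma proj_eq_proj_iff_toBall {A B : Sp11} : proj A = proj B ↔ toBall A = toBall B := by
  rw [proj_eq_proj_iff, toBall, toBall, Subtype.mk.injEq]

/-- Through every point of `Sp(1,1)` there is a smooth section of `proj`. -/
lemma exists_section_through (A : Sp11) : ∃ s : ball → Sp11,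
    ContMDiff 𝓘(ℝ, ℍ[ℝ]) 𝓘(ℝ, sp11) ∞ s ∧ s (toBall A) = A ∧
      ∀ t, proj (s t) = proj (boostSection t) := by
  have h : proj (boostSection (toBall A)) = proj A := by
    rw [proj_eq_proj_iff_toBall, toBall_boostSection]
  -- Translating the standard section by the subgroup elements `x` and `y` makes it pass through `A`
  -- without changing any double coset.
  obtain ⟨x, hx, y, hy, hA⟩ := (DoubleCoset.eq _ _ _ _).1 h
  refine ⟨fun t => x * boostSection t * y, contMDiff_of_coe_Sp11 ?_, hA.symm,
    fun t => ((DoubleCoset.eq _ _ _ _).2 ⟨x, hx, y, hy, rfl⟩).symm⟩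
  have h1 : ContMDiff 𝓘(ℝ, ℍ[ℝ]) 𝓘(ℝ, M₂) ∞ (fun t => (boostSection t : M₂)) :=
    contMDiff_coe_Sp11.comp contMDiff_boostSection
  have h2 : ContDiff ℝ ∞ (fun X : M₂ => (x : M₂) * X * (y : M₂)) :=
    (contDiff_const.mul contDiff_id).mul contDiff_const
  exact h2.contMDiff.comp h1

/-! ### The manifold structure of the double coset space -/

lemma proj_surjective : Function.Surjective proj := fun x => ⟨x.out, DoubleCoset.out_eq' _ _ x⟩

lemma continuous_proj : Continuous proj := continuous_coinduced_rng

/-- The homeomorphism from the double coset space to the ball induced by `A ↦ b d⁻¹`. -/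
def dcosetHomeomorph : DCoset ≃ₜ ball where
  toFun x := toBall x.out
  invFun t := proj (boostSection t)
  left_inv x := by
    refine Eq.trans ?_ (DoubleCoset.out_eq' _ _ x)
    exact proj_eq_proj_iff_toBall.2 (toBall_boostSection _)
  right_inv t := by
    refine Eq.trans ?_ (toBall_boostSection t)
    exact proj_eq_proj_iff_toBall.1 (DoubleCoset.out_eq' _ _ _)
  continuous_toFun := by
    -- Continuity is tested on the composite with the projection, where the chosen representative
    -- may be replaced by `A` itself.
    refine continuous_coinduced_dom.2 (contMDiff_toBall.continuous.congr fun A => ?_)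
    exact (proj_eq_proj_iff_toBall.1 (DoubleCoset.out_eq' _ _ (proj A))).symm
  continuous_invFun := continuous_proj.comp contMDiff_boostSection.continuous

lemma dcosetHomeomorph_proj (A : Sp11) : dcosetHomeomorph (proj A) = toBall A :=
  proj_eq_proj_iff_toBall.1 (DoubleCoset.out_eq' _ _ (proj A))

lemma dcosetHomeomorph_symm_apply (t : ball) :
    dcosetHomeomorph.symm t = proj (boostSection t) := rfl

/-- The global coordinates of the double coset space. -/
def dcosetCoord (x : DCoset) : EuclideanSpace ℝ (Fin 4) :=
  Quaternion.linearIsometryEquivTuple (dcosetHomeomorph x : ℍ[ℝ])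

lemma isOpenEmbedding_dcosetCoord : Topology.IsOpenEmbedding dcosetCoord :=
  Quaternion.linearIsometryEquivTuple.toHomeomorph.isOpenEmbedding.comp
    (ball.isOpen.isOpenEmbedding_subtypeVal.comp dcosetHomeomorph.isOpenEmbedding)

instance : Nonempty DCoset := ⟨proj 1⟩

/-- The manifold structure of the double coset space given by its global coordinates. -/
@[reducible] def dcosetChartedSpace : ChartedSpace (EuclideanSpace ℝ (Fin 4)) DCoset :=
  isOpenEmbedding_dcosetCoord.singletonChartedSpace

section

attribute [local instance] dcosetChartedSpace

lemma contMDiff_dcosetHomeomorph : ContMDiff (𝓡 4) 𝓘(ℝ, ℍ[ℝ]) ∞ dcosetHomeomorph := by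
  rw [← ContMDiff.subtypeVal_comp_iff]
  have h : ContMDiff (𝓡 4) (𝓡 4) ∞ dcosetCoord :=
    contMDiff_isOpenEmbedding isOpenEmbedding_dcosetCoord
  have h' := (Quaternion.linearIsometryEquivTuple.symm.contDiff (n := ∞)).contMDiff.comp h
  exact h'.congr fun x => (LinearIsometryEquiv.symm_apply_apply _ _).symm

lemma contMDiff_dcosetHomeomorph_symm : ContMDiff 𝓘(ℝ, ℍ[ℝ]) (𝓡 4) ∞ dcosetHomeomorph.symm := by
  have h : ContMDiffOn (𝓡 4) (𝓡 4) ∞ _ _ :=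
    contMDiffOn_isOpenEmbedding_symm isOpenEmbedding_dcosetCoord
  have h1 : ContMDiff 𝓘(ℝ, ℍ[ℝ]) (𝓡 4) ∞
      (fun t : ball => Quaternion.linearIsometryEquivTuple (t : ℍ[ℝ])) :=
    (Quaternion.linearIsometryEquivTuple.contDiff (n := ∞)).contMDiff.comp contMDiff_subtype_val
  have hc : ∀ t : ball, Quaternion.linearIsometryEquivTuple (t : ℍ[ℝ])
      = dcosetCoord (dcosetHomeomorph.symm t) := fun t => by simp [dcosetCoord]
  refine (h.comp_contMDiff h1 fun t => ⟨_, (hc t).symm⟩).congr fun t => ?_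
  rw [Function.comp_apply, hc]
  exact (isOpenEmbedding_dcosetCoord.toOpenPartialHomeomorph_left_inv dcosetCoord).symm

lemma contMDiff_proj : ContMDiff 𝓘(ℝ, sp11) (𝓡 4) ∞ proj := by
  refine (contMDiff_dcosetHomeomorph_symm.comp contMDiff_toBall).congr fun A => ?_
  rw [Function.comp_apply, ← dcosetHomeomorph_proj, Homeomorph.symm_apply_apply]

/-- A smooth right inverse of the projection whose image contains `A` gives, by the chain rule, a
right inverse of the differential at `A`. -/
lemma mfderiv_proj_surjective (A : Sp11) :
    Function.Surjective (mfderiv 𝓘(ℝ, sp11) (𝓡 4) proj A) := by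
  obtain ⟨s, hs, hsA, hsp⟩ := exists_section_through A
  have hA : (s ∘ dcosetHomeomorph) (proj A) = A := by
    rw [Function.comp_apply, dcosetHomeomorph_proj, hsA]
  have h1 : MDifferentiableAt (𝓡 4) 𝓘(ℝ, sp11) (s ∘ dcosetHomeomorph) (proj A) :=
    (hs.comp contMDiff_dcosetHomeomorph).mdifferentiableAt (by simp)
  have h2 : MDifferentiableAt 𝓘(ℝ, sp11) (𝓡 4) proj ((s ∘ dcosetHomeomorph) (proj A)) :=
    contMDiff_proj.mdifferentiableAt (by simp)
  have hid : proj ∘ (s ∘ dcosetHomeomorph) = id := by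
    funext x
    simp only [Function.comp_apply, hsp, ← dcosetHomeomorph_symm_apply, id,
      Homeomorph.symm_apply_apply]
  have h3 := mfderiv_comp (proj A) h2 h1
  rw [hid, mfderiv_id] at h3
  rw [← hA]
  intro v
  exact ⟨mfderiv (𝓡 4) 𝓘(ℝ, sp11) (s ∘ dcosetHomeomorph) (proj A) v,
    (DFunLike.congr_fun h3 v).symm⟩

/-- The double coset space is diffeomorphic to the ball. -/
def dcosetDiffeomorph : DCoset ≃ₘ^∞⟮𝓡 4, 𝓘(ℝ, ℍ[ℝ])⟯ ball where
  toEquiv := dcosetHomeomorph.toEquiv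
  contMDiff_toFun := contMDiff_dcosetHomeomorph
  contMDiff_invFun := contMDiff_dcosetHomeomorph_symm

end

lemma isNaturalStructure_dcosetChartedSpace : IsNaturalStructure dcosetChartedSpace where
  isManifold := isOpenEmbedding_dcosetCoord.isManifold_singleton
  isSubmersion :=
    letI := dcosetChartedSpace
    { contMDiff := contMDiff_proj
      surjective := proj_surjective
      mfderiv_surjective := mfderiv_proj_surjective }

/-- Natural structures are unique: the identity between any two of them is smooth. -/
lemma IsNaturalStructure.contMDiff_id {m n : ℕ}
    {cs : ChartedSpace (EuclideanSpace ℝ (Fin m)) DCoset}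
    {cs' : ChartedSpace (EuclideanSpace ℝ (Fin n)) DCoset}
    (h : IsNaturalStructure cs) (h' : IsNaturalStructure cs') :
    @ContMDiff ℝ _ _ _ _ _ _ (𝓡 m) DCoset _ cs _ _ _ _ _ (𝓡 n) DCoset _ cs' ∞ id := by
  have := h.isManifold
  -- The identity composed with the projection is the projection, which is smooth into the second
  -- structure.
  exact IsSubmersion.contMDiff_of_comp h.isSubmersion h'.isSubmersion.contMDiff

end RegMobius
end

open RegMobius

theorem mainTheorem5 :
    -- each `𝓕_A` is a bijection of the unit ball onto itself
    (∀ A : Sp11, Set.BijOn (regMobius A) RegMobius.ball RegMobius.ball) ∧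
    -- the double coset space is Hausdorff and second countable, and has a natural manifold
    -- structure `cs`, of dimension four,
    T2Space DCoset ∧ SecondCountableTopology DCoset ∧
    ∃ cs : ChartedSpace (EuclideanSpace ℝ (Fin 4)) DCoset,
      IsNaturalStructure cs ∧
      -- which is unique (the identity map to any other one is a diffeomorphism),
      (∀ (n : ℕ) (cs' : ChartedSpace (EuclideanSpace ℝ (Fin n)) DCoset), IsNaturalStructure cs' →
        @ContMDiff ℝ _ _ _ _ _ _ (𝓡 4) DCoset _ cs _ _ _ _ _ (𝓡 n) DCoset _ cs' ∞ id ∧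
        @ContMDiff ℝ _ _ _ _ _ _ (𝓡 n) DCoset _ cs' _ _ _ _ _ (𝓡 4) DCoset _ cs ∞ id) ∧
      -- and the double coset of `A ↦ (𝓕_{A⁻¹})⁻¹(0)` is a well-defined diffeomorphism.
      ∃ Φ : DCoset ≃ₘ^∞⟮𝓡 4, 𝓘(ℝ, ℍ[ℝ])⟯ RegMobius.ball,
        ∀ A : Sp11, {q : ℍ[ℝ] | q ∈ RegMobius.ball ∧ regMobius A⁻¹ q = 0} = {(Φ (proj A) : ℍ[ℝ])} := by
  refine ⟨regMobius_bijOn, dcosetHomeomorph.isEmbedding.t2Space,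
    dcosetHomeomorph.isEmbedding.secondCountableTopology, dcosetChartedSpace,
    isNaturalStructure_dcosetChartedSpace, fun n cs' h => ?_, dcosetDiffeomorph, fun A => ?_⟩
  · exact ⟨isNaturalStructure_dcosetChartedSpace.contMDiff_id h,
      h.contMDiff_id isNaturalStructure_dcosetChartedSpace⟩
  · have h : (dcosetDiffeomorph (proj A) : ℍ[ℝ]) = rowQuot A :=
      congrArg Subtype.val (dcosetHomeomorph_proj A)
    rw [setOf_regMobius_inv_eq_zero, h]
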